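/- Let $n\ge 3$ be an integer and let $p$ be a prime with $p\equiv 1\pmod n$. For a $p$-adic number $x$ and $k\ge 0$ put $(x)_k=\prod_{j=0}^{k-1}(x+j)$ (so $(x)_0=1$), and define the truncated hypergeometric series $$ {}_{n+1}F_{n}\bigg[\begin{matrix}x_1&x_2&\ldots&x_{n+1}\\ &y_1&\ldots&y_{n}\end{matrix}\bigg|\,z\bigg]_{m}=\sum_{k=0}^m\frac{(x_1)_k(x_2)_k\cdots(x_{n+1})_k}{(y_1)_k\cdots (y_{n})_k}\cdot\frac{z^k}{k!}. $$ Let $\Gamma_p:\mathbb Z_p\to\mathbb Z_p$ be the $p$-adic Gamma function, that is, $\Gamma_p(x)=\lim_{a\to x}\Gamma_p(a)$, where $a$ runs over the non-negative integers tending $p$-adically to $x$, and $\Gamma_p(a)=(-1)^a\prod_{1\le k<a,\ p\nmid k}k$. For $a,b\in\mathbb Q_p$ write $a\equiv b\pmod{p^3}$ if $a-b\in p^3\mathbb Z_p$. Then $$ p^n\cdot {}_{n+1}F_{n}\bigg[\begin{matrix} 1&1&\ldots&1\\ &\frac{n+1}{n}&\ldots&\frac{n+1}{n}\end{matrix}\bigg|\,1\bigg]_{p-1}\equiv-\Gamma_p\left(\frac1n\right)^n\pmod{p^3}.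 $$ Equivalently, $$ \sum_{k=0}^{p-1}\left(p\cdot\frac{k!}{(1+\frac1n)_k}\right)^n\equiv-\Gamma_p\left(\frac1n\right)^n\pmod{p^3}. $$ -/

import Mathlib

open Filter Topology

/-- The rising factorial `(x)_k = x (x + 1) ⋯ (x + k - 1)`, with `(x)_0 = 1`. -/
def risingFactorial {K : Type*} [Field K] (x : K) (k : ℕ) : K :=
  ∏ j ∈ Finset.range k, (x + (j : K))

/-- The truncated hypergeometric series
`∑_{k = 0}^{m} (x_0)_k ⋯ (x_n)_k / ((y_1)_k ⋯ (y_n)_k) * z ^ k / k!`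
with `n + 1` upper parameters and `n` lower parameters. -/
def truncatedHypergeometric {K : Type*} [Field K] {n : ℕ}
    (x : Fin (n + 1) → K) (y : Fin n → K) (z : K) (m : ℕ) : K :=
  ∑ k ∈ Finset.range (m + 1),
    (∏ i, risingFactorial (x i) k) / (∏ i, risingFactorial (y i) k) *
      (z ^ k / (k.factorial : K))

/-- The `p`-adic Gamma function on the natural numbers:
`Γ_p(a) = (-1) ^ a * ∏ k`, over the `1 ≤ k < a` that are coprime to `p`; so `Γ_p(0) = 1`. -/
noncomputable def padicGammaNat (p : ℕ) [Fact p.Prime] (a : ℕ) : ℤ_[p] :=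
  (-1) ^ a * ∏ k ∈ (Finset.Ico 1 a).filter (fun k => Nat.Coprime k p), (k : ℤ_[p])

/-- The `p`-adic Gamma function on `ℤ_[p]`: the limit of `Γ_p(a)` as the natural number `a`
tends `p`-adically to `x`. -/
noncomputable def padicGamma (p : ℕ) [Fact p.Prime] (x : ℤ_[p]) : ℤ_[p] :=
  limUnder (comap (fun a : ℕ => (a : ℤ_[p])) (𝓝 x)) (padicGammaNat p)

/-- Congruence modulo `p ^ N` in `ℚ_[p]`: the difference lies in `p ^ N ℤ_[p]`. -/
def PadicModEq (p : ℕ) [Fact p.Prime] (N : ℕ) (a b : ℚ_[p]) : Prop :=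
  ∃ z : ℤ_[p], a - b = (p : ℚ_[p]) ^ N * (z : ℚ_[p])

/-- Auxiliary factor: `j` as a residue class modulo `N`, replaced by `1` if not coprime to `p`. -/
def coprimeFactor (p N : ℕ) (j : ℕ) : ZMod N := if Nat.Coprime j p then (j : ZMod N) else 1

theorem prod_Ico_coprimeFactor (p r a : ℕ) [hp : Fact p.Prime] (hr : 1 ≤ r) :
    ∏ j ∈ Finset.Ico a (a + p ^ r), coprimeFactor p (p ^ r) j =
      ∏ j ∈ Finset.range (p ^ r), coprimeFactor p (p ^ r) j := by
  have hpos : 0 < p ^ r := pow_pos hp.out.pos r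
  induction a with
  | zero => rw [zero_add, ← Finset.range_eq_Ico]
  | succ a ih =>
    rw [← ih, Finset.prod_eq_prod_Ico_succ_bot (by omega : a < a + p ^ r),
      show a + 1 + p ^ r = (a + p ^ r) + 1 by ring,
      Finset.prod_Ico_succ_top (by omega : a + 1 ≤ a + p ^ r), mul_comm]
    congr 1
    obtain ⟨s, rfl⟩ : ∃ s, r = s + 1 := ⟨r - 1, by omega⟩
    have : Nat.Coprime (a + p ^ (s + 1)) p ↔ Nat.Coprime a p := by
      rw [pow_succ]; simp
    have h2 : ((a + p ^ (s + 1) : ℕ) : ZMod (p ^ (s + 1))) = (a : ZMod (p ^ (s + 1))) := by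
      rw [Nat.cast_add, ZMod.natCast_self, add_zero]
    unfold coprimeFactor
    simp only [this, h2]

theorem prod_range_coprimeFactor (p r : ℕ) [hp : Fact p.Prime] (hp2 : p ≠ 2) (hr : 1 ≤ r) :
    ∏ j ∈ Finset.range (p ^ r), coprimeFactor p (p ^ r) j = -1 := by
  have hpr : 2 < p ^ r := by
    have h3 : 2 < p := lt_of_le_of_ne hp.out.two_le (Ne.symm hp2)
    exact lt_of_lt_of_le h3 (Nat.le_self_pow (by omega) p)
  have : NeZero (p ^ r) := ⟨by omega⟩
  have : Fact (2 < p ^ r) := ⟨hpr⟩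
  have e1 : ∏ j ∈ Finset.range (p ^ r), coprimeFactor p (p ^ r) j =
      ∏ u : (ZMod (p ^ r))ˣ, (u : ZMod (p ^ r)) := by
    unfold coprimeFactor
    rw [← Finset.prod_filter]
    symm
    refine Finset.prod_bij (fun u _ => (u : ZMod (p ^ r)).val) ?_ ?_ ?_ ?_
    · intro u _
      simp only [Finset.mem_filter, Finset.mem_range]
      refine ⟨ZMod.val_lt _, ?_⟩
      exact (Nat.coprime_pow_right_iff (by omega) _ _).1 (ZMod.val_coe_unit_coprime u)
    · intro u _ v _ h
      exact Units.ext (ZMod.val_injective _ h)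
    · intro j hj
      simp only [Finset.mem_filter, Finset.mem_range] at hj
      refine ⟨ZMod.unitOfCoprime j (Nat.Coprime.pow_right r hj.2), Finset.mem_univ _, ?_⟩
      simp [ZMod.val_cast_of_lt hj.1]
    · intro u _
      simp
  have hinv : ∀ u : (ZMod (p ^ r))ˣ, u = u⁻¹ → u = 1 ∨ u = -1 := by
    intro u hu
    have h1 : u * u = 1 := by
      nth_rewrite 2 [hu]; simp
    have h2 : ((u : ZMod (p ^ r)).val : ℤ) * ((u : ZMod (p ^ r)).val : ℤ) - 1 =
      (((u : ZMod (p ^ r)).val : ℤ) - 1) * (((u : ZMod (p ^ r)).val : ℤ) + 1) := by ring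
    have h3 : ((p ^ r : ℕ) : ℤ) ∣ (((u : ZMod (p ^ r)).val : ℤ) - 1) *
        (((u : ZMod (p ^ r)).val : ℤ) + 1) := by
      rw [← h2, ← ZMod.intCast_zmod_eq_zero_iff_dvd]
      push_cast
      rw [ZMod.natCast_zmod_val, ← Units.val_mul, h1]; simp
    have hpi : Prime (p : ℤ) := Nat.prime_iff_prime_int.1 hp.out
    have key : ((p ^ r : ℕ) : ℤ) ∣ (((u : ZMod (p ^ r)).val : ℤ) - 1) ∨
        ((p ^ r : ℕ) : ℤ) ∣ (((u : ZMod (p ^ r)).val : ℤ) + 1) := by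
      push_cast at h3 ⊢
      by_cases hd : (p : ℤ) ∣ (((u : ZMod (p ^ r)).val : ℤ) - 1)
      · left
        refine IsCoprime.dvd_of_dvd_mul_right (IsCoprime.pow_left ?_) h3
        rw [Prime.coprime_iff_not_dvd hpi]
        intro hd2
        have := dvd_sub hd2 hd
        have h4 : (p : ℤ) ∣ 2 := by
          rw [add_sub_sub_cancel] at this
          simpa using this
        have h5 : p ∣ 2 := by exact_mod_cast h4
        exact hp2 ((Nat.prime_dvd_prime_iff_eq hp.out Nat.prime_two).1 h5)
      · right
        refine IsCoprime.dvd_of_dvd_mul_left (IsCoprime.pow_left ?_) h3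
        rwa [Prime.coprime_iff_not_dvd hpi]
    rcases key with h | h
    · left
      rw [← ZMod.intCast_zmod_eq_zero_iff_dvd] at h
      push_cast at h
      rw [ZMod.natCast_zmod_val, sub_eq_zero] at h
      exact Units.ext h
    · right
      rw [← ZMod.intCast_zmod_eq_zero_iff_dvd] at h
      push_cast at h
      rw [ZMod.natCast_zmod_val] at h
      exact Units.ext (by simpa using eq_neg_of_add_eq_zero_left h)
  have hne : (1 : (ZMod (p ^ r))ˣ) ≠ -1 := by
    intro h
    have := congrArg Units.val h
    simp only [Units.val_one, Units.val_neg] at this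
    exact ZMod.neg_one_ne_one this.symm
  classical
  have e2 : ∏ u ∈ (Finset.univ.erase (1 : (ZMod (p ^ r))ˣ)).erase (-1), u = 1 := by
    refine Finset.prod_involution (fun u _ => u⁻¹) (by simp) ?_ ?_ (by simp)
    · intro u hu _ h
      simp only [Finset.mem_erase, Finset.mem_univ, and_true] at hu
      rcases hinv u h.symm with h | h
      · exact hu.2 h
      · exact hu.1 h
    · intro u hu
      simp only [Finset.mem_erase, Finset.mem_univ, and_true, ne_eq] at hu ⊢
      refine ⟨fun h => hu.1 ?_, fun h => hu.2 (inv_eq_one.1 h)⟩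
      rw [← inv_inv u, h]; simp
  have e3 : ∏ u : (ZMod (p ^ r))ˣ, u = -1 := by
    rw [← Finset.mul_prod_erase _ _ (Finset.mem_univ (1 : (ZMod (p ^ r))ˣ)),
      ← Finset.mul_prod_erase (Finset.univ.erase (1 : (ZMod (p ^ r))ˣ)) _
        (Finset.mem_erase.2 ⟨hne.symm, Finset.mem_univ _⟩), e2]
    simp
  rw [e1, ← Units.coe_prod, e3]
  simp

theorem toZModPow_padicGammaNat (p r a : ℕ) [hp : Fact p.Prime] :
    PadicInt.toZModPow r (padicGammaNat p a) =
      (-1) ^ a * ∏ j ∈ Finset.range a, coprimeFactor p (p ^ r) j := by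
  unfold padicGammaNat coprimeFactor
  rw [← Finset.prod_filter]
  simp only [map_mul, map_pow, map_neg, map_one, map_prod, map_natCast]
  congr 1
  refine Finset.prod_congr ?_ (fun _ _ => rfl)
  ext j
  simp only [Finset.mem_filter, Finset.mem_Ico, Finset.mem_range]
  constructor
  · rintro ⟨h1, h2⟩
    exact ⟨h1.2, h2⟩
  · rintro ⟨h1, h2⟩
    refine ⟨⟨?_, h1⟩, h2⟩
    rcases Nat.eq_zero_or_pos j with rfl | h
    · rw [Nat.coprime_zero_left] at h2
      exact absurd h2 hp.out.ne_one
    · exact h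

theorem toZModPow_padicGammaNat_congr (p r : ℕ) [hp : Fact p.Prime] (hp2 : p ≠ 2) (hr : 1 ≤ r)
    {a b : ℕ} (h : a ≡ b [MOD p ^ r]) :
    PadicInt.toZModPow r (padicGammaNat p a) = PadicInt.toZModPow r (padicGammaNat p b) := by
  have step : ∀ c : ℕ, PadicInt.toZModPow r (padicGammaNat p (c + p ^ r)) =
      PadicInt.toZModPow r (padicGammaNat p c) := by
    intro c
    rw [toZModPow_padicGammaNat p r _, toZModPow_padicGammaNat p r _,
      ← Finset.prod_range_mul_prod_Ico _ (Nat.le_add_right c (p ^ r)),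
      prod_Ico_coprimeFactor p r c hr, prod_range_coprimeFactor p r hp2 hr, pow_add,
      ((hp.out.odd_of_ne_two hp2).pow).neg_one_pow]
    ring
  have steps : ∀ t c : ℕ, PadicInt.toZModPow r (padicGammaNat p (c + p ^ r * t)) =
      PadicInt.toZModPow r (padicGammaNat p c) := by
    intro t c
    induction t with
    | zero => simp
    | succ t ih => rw [mul_add, mul_one, ← add_assoc, step, ih]
  rw [← Nat.mod_add_div a (p ^ r), ← Nat.mod_add_div b (p ^ r), steps, steps, h]

/-- For odd `p` the limit that defines `padicGamma` exists at every `p`-adic integer. -/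
theorem tendsto_padicGammaNat (p : ℕ) [hp : Fact p.Prime] (hp2 : p ≠ 2) (x : ℤ_[p]) :
    Tendsto (padicGammaNat p) (comap (fun a : ℕ => (a : ℤ_[p])) (𝓝 x))
      (𝓝 (padicGamma p x)) := by
  have : NeBot (comap (fun a : ℕ => (a : ℤ_[p])) (𝓝 x)) :=
    comap_neBot_iff.2 (fun t ht => by
      obtain ⟨y, hy, a, rfl⟩ := mem_closure_iff_nhds.1 (PadicInt.denseRange_natCast x) t ht
      exact ⟨a, hy⟩)
  have hc : Cauchy (map (padicGammaNat p) (comap (fun a : ℕ => (a : ℤ_[p])) (𝓝 x))) := by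
    rw [Metric.cauchy_iff]
    refine ⟨inferInstance, fun ε hε => ?_⟩
    obtain ⟨k, hk⟩ := PadicInt.exists_pow_neg_lt p hε
    have hk' : (p : ℝ) ^ (-((k + 1 : ℕ) : ℤ)) < ε := by
      refine lt_of_le_of_lt (zpow_le_zpow_right₀ ?_ ?_) hk
      · exact_mod_cast hp.out.one_le
      · push_cast; omega
    have hclose : ∀ y z : ℤ_[p], dist y z < (p : ℝ) ^ (-((k + 1 : ℕ) : ℤ)) →
        PadicInt.toZModPow (k + 1) y = PadicInt.toZModPow (k + 1) z := by
      intro y z h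
      rw [dist_eq_norm] at h
      have h1 := (PadicInt.norm_le_pow_iff_mem_span_pow (y - z) (k + 1)).1 h.le
      rw [← PadicInt.ker_toZModPow, RingHom.mem_ker, map_sub, sub_eq_zero] at h1
      exact h1
    have hpp : (0 : ℝ) < (p : ℝ) ^ (-((k + 1 : ℕ) : ℤ)) :=
      zpow_pos (by exact_mod_cast hp.out.pos) _
    refine ⟨padicGammaNat p '' ((fun a : ℕ => (a : ℤ_[p])) ⁻¹'
      Metric.ball x ((p : ℝ) ^ (-((k + 1 : ℕ) : ℤ)))), ?_, ?_⟩
    · exact image_mem_map (preimage_mem_comap (Metric.ball_mem_nhds x hpp))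
    · rintro _ ⟨a, ha, rfl⟩ _ ⟨b, hb, rfl⟩
      have ha' := hclose _ _ (Metric.mem_ball.1 ha)
      have hb' := hclose _ _ (Metric.mem_ball.1 hb)
      have hab := ha'.trans hb'.symm
      rw [map_natCast, map_natCast, ZMod.natCast_eq_natCast_iff] at hab
      have h1 := toZModPow_padicGammaNat_congr p (k + 1) hp2 (by omega) hab
      rw [← sub_eq_zero, ← map_sub, ← RingHom.mem_ker, PadicInt.ker_toZModPow,
        ← PadicInt.norm_le_pow_iff_mem_span_pow] at h1
      rw [dist_eq_norm]
      exact lt_of_le_of_lt h1 hk'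
  obtain ⟨l, hl⟩ := cauchy_map_iff_exists_tendsto.1 hc
  exact tendsto_nhds_limUnder ⟨l, hl⟩

/-- If `p ≡ 1` modulo `n`, then `n` is a unit of `ℤ_[p]`, so that `(n : ℤ_[p]).inv` is `1 / n`. -/
theorem natCast_mul_inv_of_modEq_one (n p : ℕ) [hp : Fact p.Prime] (h : p ≡ 1 [MOD n]) :
    (n : ℤ_[p]) * (n : ℤ_[p]).inv = 1 := by
  apply PadicInt.mul_inv
  rw [PadicInt.norm_natCast_eq_one_iff]
  have h1 : Nat.gcd p n = 1 := by rw [h.gcd_eq]; simp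
  exact h1

/-!
Put `r = (p - 1) / n` and `t = p / n`, so that `1 / n = t - r`. The factor `n r + 1 = p` is the only
multiple of `p` among the `n j + 1` with `1 ≤ j < p`. Hence the terms with `k < r` are divisible by
`p ^ n` and vanish modulo `p ^ 3`, while the term with `k = r + i` is the `n`-th power of a `p`-adic
integer `z_i` with

  `z_i * A * ∏_{j ≤ i} (1 + t / j) = (i + 1) ⋯ (i + r)`,  where `A = ∏_{l ≤ r} (t - l)`

(`exists_padicInt_eq_term_of_le`). As `p = n t` and `t ^ 3 = 0` modulo `p ^ 3`,

  `(1 + t x) ^ n (1 - p x) = 1 - C(n + 1, 2) t ^ 2 x ^ 2`,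

and `∏_{j ≤ i} (1 - p / j) = (-1) ^ i C(p - 1, i)`. With `P(i) = ((i + 1) ⋯ (i + r)) ^ n` this gives

  `A ^ n * z_i ^ n = (-1) ^ i C(p - 1, i) P(i) + C(n + 1, 2) t ^ 2 P(i) ∑_{j ≤ i} 1 / j ^ 2`.

The first part is summed exactly: `P` is a monic polynomial of degree `p - 1`, and its
`(p - 1)`-st difference is `(p - 1)!`
(`sum_ascFactorial_pow_mul_neg_one_pow_mul_choose`). The second part only matters modulo `p`, and
there its sum is zero (`sum_ascFactorial_pow_mul_invSqSum_eq_zero`), for two reasons: a polynomial of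
degree less than `p - 1` has sum zero over `ZMod p`, and the sum is antisymmetric under the
reflection `i ↦ p - 1 - r - i`. So `A ^ n` times the sum is `(p - 1)!`
(`pow_mul_sum_pow_eq_factorial`).

On the other side, the functional equation of `Γ_p` gives `Γ_p(t) = (-1) ^ r A Γ_p(1 / n)`. By
a congruence of Wolstenholme type, `Γ_p(m p) = (-(p - 1)!) ^ m` modulo `p ^ 3`
(`toZModPow_padicGammaNat_mul_self`). Choosing a natural number `m` with `n m = 1` modulo `p ^ 3`, so
that `t = m p`, one gets `A ^ n Γ_p(1 / n) ^ n = (-(p - 1)!) ^ (m n) = -(p - 1)!`. Cancelling the unit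
`A ^ n` proves the congruence.
-/

/-! ### Expansions in a ring with a nilpotent element -/

theorem prod_one_add_mul_of_mul_self_eq_zero {R ι : Type*} [CommRing R] (s : Finset ι) (c : R)
    (hc : c * c = 0) (y : ι → R) : ∏ j ∈ s, (1 + c * y j) = 1 + c * ∑ j ∈ s, y j := by
  classical
  induction s using Finset.induction_on with
  | empty => simp
  | insert a s ha ih =>
    rw [Finset.prod_insert ha, Finset.sum_insert ha, ih]
    linear_combination (y a * ∑ j ∈ s, y j) * hc

theorem one_add_mul_pow_of_pow_three_eq_zero {R : Type*} [CommRing R] {t : R} (ht : t ^ 3 = 0)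
    (x : R) (n : ℕ) :
    (1 + t * x) ^ n = 1 + n * t * x + (n.choose 2 : ℕ) * t ^ 2 * x ^ 2 := by
  induction n with
  | zero => simp
  | succ n ih =>
    rw [pow_succ, ih, Nat.choose_succ_succ' n 1, Nat.choose_one_right]
    push_cast
    linear_combination ((n.choose 2 : ℕ) * x ^ 3 : R) * ht

/-- The first-order terms of the two factors cancel: this is why `∏ (1 + t / j) ^ (-n)` can be
traded for `∏ (1 - n t / j)` at the cost of a second-order correction. -/
theorem one_add_mul_pow_mul_one_sub {R : Type*} [CommRing R] {t : R} (ht : t ^ 3 = 0)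
    (x : R) (n : ℕ) :
    (1 + t * x) ^ n * (1 - n * t * x) = 1 - ((n + 1).choose 2 : ℕ) * t ^ 2 * x ^ 2 := by
  have h : ((n : R)) ^ 2 = (n.choose 2 : ℕ) + ((n + 1).choose 2 : ℕ) := by
    induction n with
    | zero => simp
    | succ n ih =>
      have e1 := congrArg (Nat.cast (R := R)) (Nat.choose_succ_succ' (n + 1) 1)
      have e2 := congrArg (Nat.cast (R := R)) (Nat.choose_succ_succ' n 1)
      rw [Nat.choose_one_right] at e1 e2
      push_cast at e1 e2 ⊢
      linear_combination ih - e1 - e2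
  rw [one_add_mul_pow_of_pow_three_eq_zero ht]
  linear_combination (-(t ^ 2 * x ^ 2)) * h - ((n.choose 2 : ℕ) * n * x ^ 3 : R) * ht

/-! ### Sums modulo a prime -/

/-- The sum `∑ 1 / j ^ 2` over `1 ≤ j ≤ i`, as a residue class modulo `N`. It is meaningful
when the `j ≤ i` are coprime to `N`. -/
def invSqSum (N i : ℕ) : ZMod N := ∑ j ∈ Finset.range i, (((j + 1 : ℕ) : ZMod N)⁻¹) ^ 2

theorem invSqSum_succ (N i : ℕ) :
    invSqSum N (i + 1) = invSqSum N i + (((i + 1 : ℕ) : ZMod N)⁻¹) ^ 2 :=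
  Finset.sum_range_succ _ _

theorem sum_range_natCast_zmod {M : Type*} [AddCommMonoid M] (p : ℕ) [NeZero p]
    (g : ZMod p → M) : ∑ i ∈ Finset.range p, g (i : ZMod p) = ∑ x : ZMod p, g x := by
  refine Finset.sum_bij' (fun i _ => (i : ZMod p)) (fun x _ => x.val) ?_ ?_ ?_ ?_ ?_
  · simp
  · intro x _
    simpa using ZMod.val_lt x
  · intro i hi
    exact ZMod.val_cast_of_lt (Finset.mem_range.1 hi)
  · simp
  · simp

theorem sum_eval_eq_zero_of_natDegree_lt (p : ℕ) [Fact p.Prime] (f : Polynomial (ZMod p))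
    (hf : f.natDegree < p - 1) : ∑ x : ZMod p, f.eval x = 0 := by
  simp_rw [Polynomial.eval_eq_sum_range]
  rw [Finset.sum_comm]
  refine Finset.sum_eq_zero fun i hi => ?_
  rw [← Finset.mul_sum, FiniteField.sum_pow_lt_card_sub_one, mul_zero]
  rw [ZMod.card]
  have := Finset.mem_range.1 hi
  omega

theorem natCast_ne_zero_zmod {p j : ℕ} (h0 : 0 < j) (hj : j < p) : (j : ZMod p) ≠ 0 := by
  rw [Ne, ZMod.natCast_eq_zero_iff]
  exact Nat.not_dvd_of_pos_of_lt h0 hj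

theorem invSqSum_pred_eq_zero (p : ℕ) [hp : Fact p.Prime] (h5 : 5 ≤ p) :
    invSqSum p (p - 1) = 0 := by
  have h1 : ∑ x : ZMod p, (x⁻¹) ^ 2 = 0 := by
    rw [← FiniteField.sum_pow_lt_card_sub_one (K := ZMod p) 2 (by rw [ZMod.card]; omega)]
    -- Inversion, with `0⁻¹ = 0`, is a permutation of `ZMod p`.
    exact Equiv.sum_comp (Equiv.inv (ZMod p)) (fun x => x ^ 2)
  rw [← sum_range_natCast_zmod p, ← Finset.sum_subset (Finset.range_subset_range.2
    (show p - 1 + 1 ≤ p by omega)) fun i hi hi' => absurd hi (by simp at hi hi' ⊢; omega),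
    Finset.sum_range_succ'] at h1
  simpa [invSqSum] using h1

theorem invSqSum_reflect (p : ℕ) [hp : Fact p.Prime] (h5 : 5 ≤ p) (m : ℕ) (hm : m ≤ p - 1) :
    invSqSum p (p - 1 - m) = -invSqSum p m := by
  induction m with
  | zero => simpa [invSqSum] using invSqSum_pred_eq_zero p h5
  | succ m ih =>
    have h := ih (by omega)
    rw [show p - 1 - m = p - 1 - (m + 1) + 1 by omega, invSqSum_succ] at h
    have e : ((p - 1 - (m + 1) + 1 : ℕ) : ZMod p) = -((m + 1 : ℕ) : ZMod p) := by
      rw [eq_neg_iff_add_eq_zero, ← Nat.cast_add,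
        show p - 1 - (m + 1) + 1 + (m + 1) = p by omega, ZMod.natCast_self]
    rw [e, inv_neg, neg_sq] at h
    rw [invSqSum_succ]
    linear_combination h

/-- The product of the `x + j` for `1 ≤ j ≤ r`. -/
noncomputable def shiftedAscPochhammer (R : Type*) [CommRing R] (r : ℕ) : Polynomial R :=
  ∏ j ∈ Finset.range r, (Polynomial.X + Polynomial.C ((j + 1 : ℕ) : R))

theorem eval_shiftedAscPochhammer (R : Type*) [CommRing R] (r i : ℕ) :
    (shiftedAscPochhammer R r).eval (i : R) = (((i + 1).ascFactorial r : ℕ) : R) := by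
  rw [shiftedAscPochhammer, Polynomial.eval_prod, Nat.ascFactorial_eq_prod_range]
  push_cast
  refine Finset.prod_congr rfl fun j _ => ?_
  simp
  ring

/-- With `f = (x + 1) ⋯ (x + r)`, the summand is the value at `i` of the polynomial
`f ^ n * ∑ j, 1 / (x + j) ^ 2 = f ^ (n - 2) * ∑ j, ∏ l ≠ j, (x + l) ^ 2`, whose degree is `p - 3`.
So its sum over `ZMod p` is zero, and it vanishes at the residues `p - r, …, p - 1`. -/
theorem sum_ascFactorial_pow_mul_sub_eq_zero (p n r : ℕ) [hp : Fact p.Prime] (hn : 3 ≤ n)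
    (hr : 1 ≤ r) (hrn : n * r = p - 1) :
    ∑ i ∈ Finset.range (p - r), (((i + 1).ascFactorial r : ℕ) : ZMod p) ^ n *
      (invSqSum p (i + r) - invSqSum p i) = 0 := by
  set q : ℕ → Polynomial (ZMod p) :=
    fun j => Polynomial.X + Polynomial.C ((j + 1 : ℕ) : ZMod p) with hq
  set f := shiftedAscPochhammer (ZMod p) r with hf
  set g := f ^ (n - 2) * ∑ j ∈ Finset.range r, ∏ l ∈ (Finset.range r).erase j, q l ^ 2 with hg
  have hqd : ∀ j, (q j).natDegree ≤ 1 := fun j => Polynomial.natDegree_X_add_C _ |>.le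
  have hfd : f.natDegree ≤ r := by
    refine (Polynomial.natDegree_prod_le _ _).trans ?_
    refine (Finset.sum_le_card_nsmul _ _ 1 fun j _ => hqd j).trans ?_
    simp
  have hgd : g.natDegree < p - 1 := by
    have h1 : (f ^ (n - 2)).natDegree ≤ (n - 2) * r :=
      Polynomial.natDegree_pow_le.trans (Nat.mul_le_mul_left _ hfd)
    have h2 : (∑ j ∈ Finset.range r, ∏ l ∈ (Finset.range r).erase j, q l ^ 2).natDegree
        ≤ (r - 1) * 2 := by
      refine Polynomial.natDegree_sum_le_of_forall_le _ _ fun j hj => ?_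
      refine (Polynomial.natDegree_prod_le _ _).trans ?_
      refine (Finset.sum_le_card_nsmul _ _ 2 fun l _ =>
        Polynomial.natDegree_pow_le.trans (Nat.mul_le_mul_left 2 (hqd l))).trans ?_
      rw [Finset.card_erase_of_mem hj]
      simp
    have h3 := Polynomial.natDegree_mul_le (p := f ^ (n - 2))
      (q := ∑ j ∈ Finset.range r, ∏ l ∈ (Finset.range r).erase j, q l ^ 2)
    have h4 : (n - 2) * r + 2 * r = n * r := by
      rw [← add_mul, Nat.sub_add_cancel (by omega)]
    rw [← hg] at h3
    omega
  have hsum := sum_eval_eq_zero_of_natDegree_lt p g hgd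
  have hrp : r ≤ p := by
    have : r ≤ n * r := Nat.le_mul_of_pos_left r (by omega)
    omega
  rw [← sum_range_natCast_zmod p, ← Finset.sum_subset
    (Finset.range_subset_range.2 (Nat.sub_le p r))] at hsum
  · rw [← hsum]
    refine Finset.sum_congr rfl fun i hi => ?_
    have hi' := Finset.mem_range.1 hi
    have hq0 : ∀ j ∈ Finset.range r, (q j).eval (i : ZMod p) = ((i + j + 1 : ℕ) : ZMod p) ∧
        (q j).eval (i : ZMod p) ≠ 0 := by
      intro j hj
      have hj' := Finset.mem_range.1 hj
      have e : (q j).eval (i : ZMod p) = ((i + j + 1 : ℕ) : ZMod p) := by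
        simp [hq]; ring
      exact ⟨e, e ▸ natCast_ne_zero_zmod (by omega) (by omega)⟩
    have hdiff : invSqSum p (i + r) - invSqSum p i =
        ∑ j ∈ Finset.range r, (((i + j + 1 : ℕ) : ZMod p)⁻¹) ^ 2 := by
      rw [invSqSum, invSqSum, Finset.sum_range_add]
      ring
    rw [hdiff, ← eval_shiftedAscPochhammer, ← hf, hg, Polynomial.eval_mul, Polynomial.eval_pow,
      Polynomial.eval_finsetSum, ← Nat.sub_add_cancel (show 2 ≤ n by omega), pow_add,
      Nat.add_sub_cancel, mul_assoc, Finset.mul_sum]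
    congr 1
    refine Finset.sum_congr rfl fun j hj => ?_
    rw [Polynomial.eval_prod, ← (hq0 j hj).1]
    have e : f.eval (i : ZMod p) = (q j).eval (i : ZMod p) *
        ∏ l ∈ (Finset.range r).erase j, (q l).eval (i : ZMod p) := by
      rw [hf, shiftedAscPochhammer, Polynomial.eval_prod, ← Finset.mul_prod_erase _ _ hj]
    simp_rw [Polynomial.eval_pow, Finset.prod_pow]
    rw [e]
    have := (hq0 j hj).2
    field_simp
  · intro i hi hi'
    rw [Finset.mem_range] at hi hi'
    have h0 : f.eval (i : ZMod p) = 0 := by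
      rw [hf, shiftedAscPochhammer, Polynomial.eval_prod]
      refine Finset.prod_eq_zero (i := p - 1 - i) (Finset.mem_range.2 (by omega)) ?_
      simp only [Polynomial.eval_add, Polynomial.eval_X, Polynomial.eval_C]
      rw [← Nat.cast_add, show i + (p - 1 - i + 1) = p by omega, ZMod.natCast_self]
    rw [hg, Polynomial.eval_mul, Polynomial.eval_pow, h0, zero_pow (by omega), zero_mul]

theorem ascFactorial_reflect (p r i : ℕ) (h : i + r < p) :
    (((p - 1 - r - i + 1).ascFactorial r : ℕ) : ZMod p) =
      (-1) ^ r * (((i + 1).ascFactorial r : ℕ) : ZMod p) := by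
  rw [Nat.ascFactorial_eq_prod_range, Nat.ascFactorial_eq_prod_range, Nat.cast_prod,
    Nat.cast_prod, ← Finset.prod_range_reflect]
  rw [← Finset.card_range r, ← Finset.prod_const, Finset.card_range, ← Finset.prod_mul_distrib]
  refine Finset.prod_congr rfl fun j hj => ?_
  have hj' := Finset.mem_range.1 hj
  rw [neg_one_mul, eq_neg_iff_add_eq_zero, ← Nat.cast_add,
    show p - 1 - r - i + 1 + (r - 1 - j) + (i + 1 + j) = p by omega, ZMod.natCast_self]

/-- Write `S(i)` for `∑ 1 / j ^ 2` over `j ≤ i` and `P(i)` for the power of the rising product. The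
reflection `i ↦ p - 1 - r - i` fixes `P` and turns `S(i)` into `-S(i + r)`, so
`∑ P(i) S(i) = -∑ P(i) S(i + r)`; but these two sums are also equal. -/
theorem sum_ascFactorial_pow_mul_invSqSum_eq_zero (p n r : ℕ) [hp : Fact p.Prime] (hn : 3 ≤ n)
    (h5 : 5 ≤ p) (hr : 1 ≤ r) (hrn : n * r = p - 1) :
    ∑ i ∈ Finset.range (p - r), (((i + 1).ascFactorial r : ℕ) : ZMod p) ^ n *
      invSqSum p i = 0 := by
  have hodd : Even (r * n) := by
    rw [mul_comm, hrn]
    exact (hp.out.odd_of_ne_two (by omega)).tsub_odd odd_one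
  have h1 := sum_ascFactorial_pow_mul_sub_eq_zero p n r hn hr hrn
  have h2 : ∑ i ∈ Finset.range (p - r), (((i + 1).ascFactorial r : ℕ) : ZMod p) ^ n *
      invSqSum p i = -∑ i ∈ Finset.range (p - r), (((i + 1).ascFactorial r : ℕ) : ZMod p) ^ n *
      invSqSum p (i + r) := by
    rw [← Finset.sum_range_reflect, ← Finset.sum_neg_distrib]
    refine Finset.sum_congr rfl fun i hi => ?_
    have hi' := Finset.mem_range.1 hi
    rw [show p - r - 1 - i = p - 1 - r - i by omega, ascFactorial_reflect p r i (by omega),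
      mul_pow, ← pow_mul, hodd.neg_one_pow, one_mul,
      show p - 1 - r - i = p - 1 - (i + r) by omega, invSqSum_reflect p h5 _ (by omega)]
    ring
  simp_rw [mul_sub] at h1
  rw [Finset.sum_sub_distrib] at h1
  have h3 : (2 : ZMod p) ≠ 0 := by
    exact_mod_cast natCast_ne_zero_zmod (p := p) (j := 2) (by omega) (by omega)
  refine (mul_eq_zero.1 (?_ : (2 : ZMod p) * _ = 0)).resolve_left h3
  linear_combination h2 - h1

/-- The `d`-th difference of a monic polynomial of degree `d = n r` is `d!`. -/
theorem sum_ascFactorial_pow_mul_neg_one_pow_mul_choose (R : Type*) [CommRing R] [Nontrivial R]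
    (n r : ℕ) :
    ∑ i ∈ Finset.range (n * r + 1), (((i + 1).ascFactorial r : ℕ) : R) ^ n *
      ((-1) ^ (n * r - i) * ((n * r).choose i : ℕ)) = ((n * r).factorial : R) := by
  set f := shiftedAscPochhammer R r ^ n with hf
  have hm : (shiftedAscPochhammer R r).Monic :=
    Polynomial.monic_prod_of_monic _ _ fun j _ => Polynomial.monic_X_add_C _
  have hd : f.natDegree = n * r := by
    rw [hf, hm.natDegree_pow, shiftedAscPochhammer,
      Polynomial.natDegree_prod_of_monic _ _ fun j _ => Polynomial.monic_X_add_C _,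
      Finset.sum_congr rfl fun j _ => Polynomial.natDegree_X_add_C _]
    simp
  have h := congrFun (Polynomial.fwdDiff_iter_degree_eq_factorial f) 0
  rw [(hm.pow n).leadingCoeff, one_smul, hd, fwdDiff_iter_eq_sum_shift] at h
  simp only [Pi.natCast_apply] at h
  rw [← h]
  refine Finset.sum_congr rfl fun i _ => ?_
  rw [hf, zero_add, nsmul_one, Polynomial.eval_pow, eval_shiftedAscPochhammer, zsmul_eq_mul]
  push_cast
  ring

/-! ### Residue classes modulo the cube of a prime -/

/-- Residue classes modulo `p ^ 3`. -/
abbrev ZModCube (p : ℕ) : Type := ZMod (p ^ 3)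

/-- Reduction from residue classes modulo `p ^ 3` to residue classes modulo `p`. -/
def reduceCube (p : ℕ) : ZModCube p →+* ZMod p :=
  ZMod.castHom (dvd_pow_self p three_ne_zero) (ZMod p)

theorem natCast_pow_three_eq_zero (p : ℕ) : (p : ZModCube p) ^ 3 = 0 := by
  rw [← Nat.cast_pow, ZMod.natCast_self]

theorem dvd_of_reduceCube_eq_zero {p : ℕ} [hp : Fact p.Prime] {y : ZModCube p}
    (hy : reduceCube p y = 0) : (p : ZModCube p) ∣ y := by
  have : NeZero (p ^ 3) := ⟨pow_ne_zero _ hp.out.ne_zero⟩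
  rw [← ZMod.natCast_zmod_val y, map_natCast, ZMod.natCast_eq_zero_iff] at hy
  rw [← ZMod.natCast_zmod_val y]
  exact Nat.cast_dvd_cast hy

theorem sq_mul_eq_zero_of_reduceCube_eq_zero {p : ℕ} [hp : Fact p.Prime] {y : ZModCube p}
    (hy : reduceCube p y = 0) : (p : ZModCube p) ^ 2 * y = 0 := by
  obtain ⟨c, rfl⟩ := dvd_of_reduceCube_eq_zero hy
  linear_combination c * natCast_pow_three_eq_zero p

theorem isUnit_of_reduceCube_ne_zero {p : ℕ} [hp : Fact p.Prime] {y : ZModCube p}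
    (hy : reduceCube p y ≠ 0) : IsUnit y := by
  have : NeZero (p ^ 3) := ⟨pow_ne_zero _ hp.out.ne_zero⟩
  rw [← ZMod.natCast_zmod_val y, map_natCast, Ne, ZMod.natCast_eq_zero_iff] at hy
  rw [← ZMod.natCast_zmod_val y, ZMod.isUnit_iff_coprime]
  exact (((Nat.Prime.coprime_iff_not_dvd hp.out).2 hy).symm).pow_right 3

theorem isUnit_natCast_of_pos_of_lt {p j : ℕ} [hp : Fact p.Prime] (h0 : 0 < j) (hj : j < p) :
    IsUnit (j : ZModCube p) :=
  isUnit_of_reduceCube_ne_zero (by rw [map_natCast]; exact natCast_ne_zero_zmod h0 hj)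

theorem natCast_mul_inv_of_lt {p j : ℕ} [hp : Fact p.Prime] (h0 : 0 < j) (hj : j < p) :
    (j : ZModCube p) * (j : ZModCube p)⁻¹ = 1 :=
  ZMod.mul_inv_of_unit _ (isUnit_natCast_of_pos_of_lt h0 hj)

theorem isUnit_factorial {p i : ℕ} [hp : Fact p.Prime] (hi : i < p) :
    IsUnit ((i.factorial : ℕ) : ZModCube p) := by
  rw [ZMod.isUnit_iff_coprime]
  exact ((hp.out.coprime_factorial_of_lt hi).symm).pow_right 3

theorem reduceCube_inv {p j : ℕ} [hp : Fact p.Prime] (h0 : 0 < j) (hj : j < p) :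
    reduceCube p (j : ZModCube p)⁻¹ = (j : ZMod p)⁻¹ := by
  refine eq_inv_of_mul_eq_one_right ?_
  rw [← map_natCast (reduceCube p), ← map_mul, natCast_mul_inv_of_lt h0 hj, map_one]

theorem reduceCube_invSqSum {p i : ℕ} [hp : Fact p.Prime] (hi : i < p) :
    reduceCube p (invSqSum (p ^ 3) i) = invSqSum p i := by
  rw [invSqSum, invSqSum, map_sum]
  refine Finset.sum_congr rfl fun j hj => ?_
  have := Finset.mem_range.1 hj
  rw [map_pow, reduceCube_inv (by omega) (by omega)]

/-! ### The sum of the nonvanishing terms -/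

theorem neg_one_pow_mul_choose_pred (p i : ℕ) [hp : Fact p.Prime] (hi : i < p) :
    (-1) ^ i * (((p - 1).choose i : ℕ) : ZModCube p) =
      ∏ j ∈ Finset.range i, (1 - p * ((j + 1 : ℕ) : ZModCube p)⁻¹) := by
  induction i with
  | zero => simp
  | succ i ih =>
    rw [Finset.prod_range_succ, ← ih (by omega)]
    have h := congrArg (Nat.cast (R := ZModCube p)) (Nat.choose_succ_right_eq (p - 1) i)
    have e : ((p - 1 - i : ℕ) : ZModCube p) = p - ((i + 1 : ℕ) : ZModCube p) := by
      rw [eq_sub_iff_add_eq, ← Nat.cast_add, show p - 1 - i + (i + 1) = p by omega]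
    have hu := natCast_mul_inv_of_lt (p := p) (j := i + 1) (by omega) hi
    rw [Nat.cast_mul, Nat.cast_mul, e] at h
    rw [pow_succ (-1 : ZModCube p)]
    linear_combination (-(-1) ^ i * ((i + 1 : ℕ) : ZModCube p)⁻¹) * h +
      ((-1) ^ i * (((p - 1).choose (i + 1) : ℕ) : ZModCube p) +
        (-1) ^ i * (((p - 1).choose i : ℕ) : ZModCube p)) * hu

theorem prod_one_add_pow_mul_prod_one_sub (p n i : ℕ) {t : ZModCube p}
    (hnt : (n : ZModCube p) * t = p) (ht : t ^ 3 = 0) :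
    (∏ j ∈ Finset.range i, (1 + t * ((j + 1 : ℕ) : ZModCube p)⁻¹)) ^ n *
      ∏ j ∈ Finset.range i, (1 - p * ((j + 1 : ℕ) : ZModCube p)⁻¹) =
      1 - (((n + 1).choose 2 : ℕ) : ZModCube p) * t ^ 2 * invSqSum (p ^ 3) i := by
  have h := prod_one_add_mul_of_mul_self_eq_zero (Finset.range i)
    (-((((n + 1).choose 2 : ℕ) : ZModCube p) * t ^ 2)) (by
      linear_combination ((((n + 1).choose 2 : ℕ) : ZModCube p) ^ 2 * t : ZModCube p) * ht)
    (fun j => (((j + 1 : ℕ) : ZModCube p)⁻¹) ^ 2)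
  rw [← invSqSum] at h
  rw [← Finset.prod_pow, ← Finset.prod_mul_distrib, sub_eq_add_neg, ← neg_mul, ← h]
  refine Finset.prod_congr rfl fun j _ => ?_
  rw [← hnt, one_add_mul_pow_mul_one_sub ht]
  ring

theorem sq_mul_prod_one_sub (p i n : ℕ) {t : ZModCube p} (hnt : (n : ZModCube p) * t = p)
    (ht : t ^ 3 = 0) (x : ℕ → ZModCube p) :
    t ^ 2 * ∏ j ∈ Finset.range i, (1 - p * x j) = t ^ 2 := by
  induction i with
  | zero => simp
  | succ i ih =>
    rw [Finset.prod_range_succ, ← mul_assoc, ih, ← hnt]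
    linear_combination (-(n : ZModCube p) * x i) * ht

/-- The sum of the `n`-th powers of the solutions `z i` of
`z i * A * ∏ j ≤ i, (1 + t / j) = (i + 1) ⋯ (i + r)`, where `t = m p` stands for `p / n`. -/
theorem pow_mul_sum_pow_eq_factorial (p n r : ℕ) [hp : Fact p.Prime] (hn : 3 ≤ n) (h5 : 5 ≤ p)
    (hr : 1 ≤ r) (hrn : n * r = p - 1) (m : ZModCube p) (hm : (n : ZModCube p) * m = 1)
    (A : ZModCube p) (z : ℕ → ZModCube p)
    (hz : ∀ i < p - r, z i * A * ∏ j ∈ Finset.range i,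
      (1 + m * p * ((j + 1 : ℕ) : ZModCube p)⁻¹) = (((i + 1).ascFactorial r : ℕ) : ZModCube p)) :
    A ^ n * ∑ i ∈ Finset.range (p - r), z i ^ n = (((p - 1).factorial : ℕ) : ZModCube p) := by
  have : Fact (1 < p ^ 3) := ⟨Nat.one_lt_pow three_ne_zero hp.out.one_lt⟩
  obtain ⟨t, ht⟩ : ∃ t, t = m * p := ⟨_, rfl⟩
  rw [← ht] at hz
  have hp3 := natCast_pow_three_eq_zero p
  have hnt : (n : ZModCube p) * t = p := by rw [ht]; linear_combination (p : ZModCube p) * hm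
  have ht3 : t ^ 3 = 0 := by rw [ht]; linear_combination m ^ 3 * hp3
  have heven : Even (p - 1) := (hp.out.odd_of_ne_two (by omega)).tsub_odd odd_one
  set e : ZModCube p := (((n + 1).choose 2 : ℕ) : ZModCube p) with he
  have hterm : ∀ i ∈ Finset.range (p - r), A ^ n * z i ^ n =
      (((i + 1).ascFactorial r : ℕ) : ZModCube p) ^ n *
        ((-1) ^ (p - 1 - i) * (((p - 1).choose i : ℕ) : ZModCube p)) +
      e * t ^ 2 * ((((i + 1).ascFactorial r : ℕ) : ZModCube p) ^ n * invSqSum (p ^ 3) i) := by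
    intro i hi
    have hi' := Finset.mem_range.1 hi
    have hsign : ((-1) ^ (p - 1 - i) : ZModCube p) = (-1) ^ i := by
      refine neg_one_pow_congr ?_
      rw [Nat.even_sub (by omega)]
      simp [heven]
    rw [hsign, neg_one_pow_mul_choose_pred p i (by omega)]
    have h1 := congrArg (· ^ n) (hz i hi')
    simp only [mul_pow] at h1
    have h2 := prod_one_add_pow_mul_prod_one_sub p n i hnt ht3
    have h3 := sq_mul_prod_one_sub p i n hnt ht3 fun j => ((j + 1 : ℕ) : ZModCube p)⁻¹
    rw [← he] at h2
    set C := ∏ j ∈ Finset.range i, (1 - p * ((j + 1 : ℕ) : ZModCube p)⁻¹)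
    set E := (∏ j ∈ Finset.range i, (1 + t * ((j + 1 : ℕ) : ZModCube p)⁻¹)) ^ n
    set P := (((i + 1).ascFactorial r : ℕ) : ZModCube p) ^ n
    set H := invSqSum (p ^ 3) i
    linear_combination (C * (1 + e * t ^ 2 * H)) * h1 -
      (A ^ n * z i ^ n * (1 + e * t ^ 2 * H)) * h2 + (P * e * H) * h3 +
      (A ^ n * z i ^ n * e ^ 2 * t * H ^ 2) * ht3
  rw [Finset.mul_sum, Finset.sum_congr rfl hterm, Finset.sum_add_distrib, ← Finset.mul_sum]
  have hfull := sum_ascFactorial_pow_mul_neg_one_pow_mul_choose (ZModCube p) n r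
  have hzero : t ^ 2 * ∑ i ∈ Finset.range (p - r),
      (((i + 1).ascFactorial r : ℕ) : ZModCube p) ^ n * invSqSum (p ^ 3) i = 0 := by
    have : reduceCube p (∑ i ∈ Finset.range (p - r),
        (((i + 1).ascFactorial r : ℕ) : ZModCube p) ^ n * invSqSum (p ^ 3) i) = 0 := by
      rw [map_sum, ← sum_ascFactorial_pow_mul_invSqSum_eq_zero p n r hn h5 hr hrn]
      refine Finset.sum_congr rfl fun i hi => ?_
      have := Finset.mem_range.1 hi
      rw [map_mul, map_pow, map_natCast, reduceCube_invSqSum (by omega)]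
    rw [ht]
    linear_combination m ^ 2 * sq_mul_eq_zero_of_reduceCube_eq_zero this
  rw [mul_assoc, hzero, mul_zero, add_zero, ← hrn, ← hfull, hrn, Nat.sub_add_cancel hp.out.one_le]
  -- For `p - r ≤ i < p` the product `(i + 1) ⋯ (i + r)` contains `p`, and `3 ≤ n`.
  refine Finset.sum_subset (Finset.range_subset_range.2 (Nat.sub_le p r)) fun i hi hi' => ?_
  rw [Finset.mem_range] at hi hi'
  have hd : p ∣ (i + 1).ascFactorial r := by
    rw [Nat.ascFactorial_eq_prod_range]
    exact (dvd_of_eq (by omega)).trans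
      (Finset.dvd_prod_of_mem (fun j => i + 1 + j) (Finset.mem_range.2 (by omega : p - 1 - i < r)))
  obtain ⟨c, hc⟩ := hd
  rw [hc, Nat.cast_mul, mul_pow, ← Nat.sub_add_cancel hn, pow_add (p : ZModCube p), hp3]
  ring

/-! ### The `p`-adic Gamma function modulo the cube of a prime -/

/-- A form of Wolstenholme's theorem: `(b p + 1) ⋯ (b p + p - 1) = (p - 1)!` modulo `p ^ 3`. Pairing
`j` with `p - j` gives `(b p + j) (b p + p - j) = j (p - j) + b (b + 1) p ^ 2`, so that the squares of
both sides agree because `∑ 1 / j ^ 2 = 0` modulo `p`; and the sum of both sides is a unit. -/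
theorem prod_mul_add_eq_factorial (p : ℕ) [hp : Fact p.Prime] (h5 : 5 ≤ p) (b : ZModCube p) :
    ∏ j ∈ Finset.range (p - 1), (b * p + ((j + 1 : ℕ) : ZModCube p)) =
      (((p - 1).factorial : ℕ) : ZModCube p) := by
  have hp3 := natCast_pow_three_eq_zero p
  set F : ZModCube p → ZModCube p := fun b =>
    ∏ j ∈ Finset.range (p - 1), (b * p + ((j + 1 : ℕ) : ZModCube p)) with hF
  have hF0 : F 0 = (((p - 1).factorial : ℕ) : ZModCube p) := by
    rw [hF, ← Finset.prod_range_add_one_eq_factorial, Nat.cast_prod]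
    simp
  set u : ℕ → ZModCube p := fun j =>
    ((j + 1 : ℕ) : ZModCube p) * (p - ((j + 1 : ℕ) : ZModCube p)) with hu
  set v : ℕ → ZModCube p := fun j =>
    ((j + 1 : ℕ) : ZModCube p)⁻¹ * ((p - (j + 1) : ℕ) : ZModCube p)⁻¹ with hv
  have hcast : ∀ j < p - 1, ((p - (j + 1) : ℕ) : ZModCube p) =
      p - ((j + 1 : ℕ) : ZModCube p) := fun j hj => Nat.cast_sub (by omega)
  have huv : ∀ j < p - 1, u j * v j = 1 := by
    intro j hj
    have h1 := natCast_mul_inv_of_lt (p := p) (j := j + 1) (by omega) (by omega)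
    have h2 := natCast_mul_inv_of_lt (p := p) (j := p - (j + 1)) (by omega) (by omega)
    simp only [hu, hv]
    rw [← hcast j hj]
    linear_combination
      (((p - (j + 1) : ℕ) : ZModCube p) * ((p - (j + 1) : ℕ) : ZModCube p)⁻¹) * h1 + h2
  have hsq : ∀ b, F b ^ 2 = (∏ j ∈ Finset.range (p - 1), u j) *
      (1 + (b * (b + 1) * p ^ 2) * ∑ j ∈ Finset.range (p - 1), v j) := by
    intro b
    rw [← prod_one_add_mul_of_mul_self_eq_zero _ _ (by
      linear_combination (b ^ 2 * (b + 1) ^ 2 * p : ZModCube p) * hp3), sq]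
    nth_rewrite 2 [hF]
    simp only
    rw [← Finset.prod_range_reflect, ← Finset.prod_mul_distrib, ← Finset.prod_mul_distrib]
    refine Finset.prod_congr rfl fun j hj => ?_
    have hj' := Finset.mem_range.1 hj
    rw [show p - 1 - 1 - j + 1 = p - (j + 1) by omega, hcast j hj']
    have := huv j hj'
    simp only [hu] at this ⊢
    linear_combination (-(b * (b + 1) * p ^ 2)) * this
  have hsum : (p : ZModCube p) ^ 2 * ∑ j ∈ Finset.range (p - 1), v j = 0 := by
    refine sq_mul_eq_zero_of_reduceCube_eq_zero ?_
    rw [map_sum, ← neg_zero, ← invSqSum_pred_eq_zero p h5, invSqSum, ← Finset.sum_neg_distrib]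
    refine Finset.sum_congr rfl fun j hj => ?_
    have hj' := Finset.mem_range.1 hj
    rw [hv, map_mul, reduceCube_inv (by omega) (by omega), reduceCube_inv (by omega) (by omega),
      Nat.cast_sub (by omega), ZMod.natCast_self, zero_sub, inv_neg]
    ring
  have hunit : IsUnit (F b + F 0) := by
    refine isUnit_of_reduceCube_ne_zero ?_
    have hb : reduceCube p (F b) = reduceCube p (F 0) := by
      simp only [hF, map_prod, map_add, map_mul, map_natCast, ZMod.natCast_self, mul_zero]
    have h2 : (2 : ZMod p) ≠ 0 := by
      exact_mod_cast natCast_ne_zero_zmod (p := p) (j := 2) (by omega) (by omega)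
    rw [map_add, hb, hF0, map_natCast, ← two_mul, ZMod.wilsons_lemma]
    exact mul_ne_zero h2 (neg_ne_zero.2 one_ne_zero)
  rw [← hF0, ← sub_eq_zero]
  refine hunit.mul_left_eq_zero.1 ?_
  linear_combination hsq b - hsq 0 +
    (b * (b + 1)) * (∏ j ∈ Finset.range (p - 1), u j) * hsum

theorem toZModPow_eq_iff_exists_mul (p N : ℕ) [Fact p.Prime] (x y : ℤ_[p]) :
    PadicInt.toZModPow N x = PadicInt.toZModPow N y ↔ ∃ z : ℤ_[p], x - y = (p : ℤ_[p]) ^ N * z := by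
  rw [← sub_eq_zero, ← map_sub, ← RingHom.mem_ker, PadicInt.ker_toZModPow,
    Ideal.mem_span_singleton]
  rfl

theorem eventually_toZModPow_eq (p N : ℕ) [hp : Fact p.Prime] (x : ℤ_[p]) :
    ∀ᶠ y in 𝓝 x, PadicInt.toZModPow N y = PadicInt.toZModPow N x := by
  have hpp : (0 : ℝ) < (p : ℝ) ^ (-(N : ℤ)) := zpow_pos (by exact_mod_cast hp.out.pos) _
  filter_upwards [Metric.ball_mem_nhds x hpp] with y hy
  rw [Metric.mem_ball, dist_eq_norm] at hy
  have h1 := (PadicInt.norm_le_pow_iff_mem_span_pow (y - x) N).1 hy.le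
  rwa [← PadicInt.ker_toZModPow, RingHom.mem_ker, map_sub, sub_eq_zero] at h1

/-- Modulo `p ^ r`, the value `Γ_p(x)` depends only on `x` modulo `p ^ r`, so that it may be
computed at a natural number. -/
theorem toZModPow_padicGamma_eq (p r a : ℕ) [hp : Fact p.Prime] (hp2 : p ≠ 2) (hr : 1 ≤ r)
    (x : ℤ_[p]) (hx : PadicInt.toZModPow r x = (a : ZMod (p ^ r))) :
    PadicInt.toZModPow r (padicGamma p x) = PadicInt.toZModPow r (padicGammaNat p a) := by
  have : NeBot (comap (fun a : ℕ => (a : ℤ_[p])) (𝓝 x)) :=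
    comap_neBot_iff.2 (fun t ht => by
      obtain ⟨y, hy, a, rfl⟩ := mem_closure_iff_nhds.1 (PadicInt.denseRange_natCast x) t ht
      exact ⟨a, hy⟩)
  have h1 := (tendsto_padicGammaNat p hp2 x).eventually (eventually_toZModPow_eq p r _)
  have h2 := (tendsto_comap (f := fun a : ℕ => (a : ℤ_[p])) (x := 𝓝 x)).eventually
    (eventually_toZModPow_eq p r x)
  obtain ⟨b, hb1, hb2⟩ := (h1.and h2).exists
  rw [← hb1]
  rw [hx, map_natCast, ZMod.natCast_eq_natCast_iff] at hb2
  exact toZModPow_padicGammaNat_congr p r hp2 hr hb2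

theorem coprime_of_pos_of_lt {p j : ℕ} (hp : p.Prime) (h0 : 0 < j) (hj : j < p) :
    Nat.Coprime j p :=
  (Nat.coprime_of_lt_prime h0.ne' hj hp).symm

/-- Each block of `p` consecutive factors contributes `-(p - 1)!`. -/
theorem toZModPow_padicGammaNat_mul_self (p m : ℕ) [hp : Fact p.Prime] (h5 : 5 ≤ p) :
    PadicInt.toZModPow 3 (padicGammaNat p (m * p)) =
      (-(((p - 1).factorial : ℕ) : ZModCube p)) ^ m := by
  have hodd : Odd p := hp.out.odd_of_ne_two (by omega)
  rw [toZModPow_padicGammaNat]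
  induction m with
  | zero => simp
  | succ m ih =>
    rw [pow_succ (-(((p - 1).factorial : ℕ) : ZModCube p)), ← ih, add_mul, one_mul,
      Finset.prod_range_add, pow_add, hodd.neg_one_pow]
    have h : ∏ x ∈ Finset.range p, coprimeFactor p (p ^ 3) (m * p + x) =
        (((p - 1).factorial : ℕ) : ZModCube p) := by
      rw [← prod_mul_add_eq_factorial p h5 m]
      have hsplit := Finset.prod_range_succ' (fun x => coprimeFactor p (p ^ 3) (m * p + x)) (p - 1)
      rw [Nat.sub_add_cancel hp.out.one_le] at hsplit
      -- The multiple of `p` in the block contributes the factor `1`.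
      have h0 : coprimeFactor p (p ^ 3) (m * p + 0) = 1 := by
        rw [coprimeFactor, if_neg]
        simp [hp.out.ne_one]
      rw [hsplit, h0, mul_one]
      refine Finset.prod_congr rfl fun j hj => ?_
      have hj' := Finset.mem_range.1 hj
      rw [coprimeFactor, if_pos]
      · push_cast
        ring
      · simpa using coprime_of_pos_of_lt hp.out (by omega : 0 < j + 1) (by omega)
    rw [h]
    ring

/-- The functional equation `Γ_p(x + 1) = -x Γ_p(x)` for units `x`, used `r` times going down
from a multiple `m p` of `p`. -/
theorem toZModPow_padicGammaNat_mul_self_sub (p m a r : ℕ) [hp : Fact p.Prime] (hr : r < p)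
    (har : a + r = m * p) :
    PadicInt.toZModPow 3 (padicGammaNat p (m * p)) =
      (-1) ^ r * (∏ l ∈ Finset.range r, ((m : ZModCube p) * p - ((l + 1 : ℕ) : ZModCube p))) *
        PadicInt.toZModPow 3 (padicGammaNat p a) := by
  rw [toZModPow_padicGammaNat, toZModPow_padicGammaNat, ← har, Finset.prod_range_add, pow_add]
  have h : ∏ x ∈ Finset.range r, coprimeFactor p (p ^ 3) (a + x) =
      ∏ l ∈ Finset.range r, ((m : ZModCube p) * p - ((l + 1 : ℕ) : ZModCube p)) := by
    rw [← Finset.prod_range_reflect]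
    refine Finset.prod_congr rfl fun l hl => ?_
    have hl' := Finset.mem_range.1 hl
    have hcop : Nat.Coprime (a + (r - 1 - l)) p := by
      have h1 : Nat.Coprime (l + 1) p := coprime_of_pos_of_lt hp.out (by omega) (by omega)
      have h2 : a + (r - 1 - l) + (l + 1) = m * p := by omega
      rw [Nat.coprime_comm, Nat.Prime.coprime_iff_not_dvd hp.out] at h1 ⊢
      intro hd
      exact h1 ((Nat.dvd_add_right hd).1 (h2 ▸ dvd_mul_left p m))
    rw [coprimeFactor, if_pos hcop, eq_sub_iff_add_eq, ← Nat.cast_add,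
      show a + (r - 1 - l) + (l + 1) = m * p by omega, Nat.cast_mul]
  rw [h]
  ring

/-- By Wilson's theorem `-(p - 1)!` is `1` modulo `p`, so its `p ^ 2`-th power is `1` modulo
`p ^ 3`. -/
theorem neg_factorial_pow_eq_self_of_modEq_one (p n m : ℕ) [hp : Fact p.Prime]
    (hmn : n * m ≡ 1 [MOD p ^ 3]) (hnm : 1 ≤ n * m) :
    (-(((p - 1).factorial : ℕ) : ZModCube p)) ^ (m * n) =
      -(((p - 1).factorial : ℕ) : ZModCube p) := by
  obtain ⟨s, hs⟩ := (Nat.modEq_iff_dvd' hnm).1 hmn.symm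
  have hw : (p : ZModCube p) ∣ -(((p - 1).factorial : ℕ) : ZModCube p) - 1 := by
    refine dvd_of_reduceCube_eq_zero ?_
    rw [map_sub, map_neg, map_natCast, ZMod.wilsons_lemma, map_one]
    ring
  have h := dvd_sub_pow_of_dvd_sub hw 2
  rw [natCast_pow_three_eq_zero, zero_dvd_iff, one_pow, sub_eq_zero] at h
  have e : m * n = p ^ 2 * (p * s) + 1 := by
    have : p ^ 3 * s = p ^ 2 * (p * s) := by ring
    rw [mul_comm m n]
    omega
  rw [e, pow_succ, pow_mul, h, one_pow, one_mul]

/-! ### The terms of the series as `p`-adic integers -/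

theorem exists_padicInt_mul_natCast_eq (p : ℕ) [Fact p.Prime] (x : ℚ_[p]) (D N : ℕ)
    (hD : Nat.Coprime D p) (h : x * D = N) :
    ∃ z : ℤ_[p], (z : ℚ_[p]) = x ∧ z * D = N := by
  have hu : (D : ℤ_[p]) * (D : ℤ_[p]).inv = 1 := by
    apply PadicInt.mul_inv
    rw [PadicInt.norm_natCast_eq_one_iff]
    exact hD.symm
  have hu' : (D : ℚ_[p]) * (((D : ℤ_[p]).inv : ℤ_[p]) : ℚ_[p]) = 1 := by
    exact_mod_cast congrArg (fun y : ℤ_[p] => (y : ℚ_[p])) hu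
  refine ⟨N * (D : ℤ_[p]).inv, ?_, ?_⟩
  · push_cast
    linear_combination (-(((D : ℤ_[p]).inv : ℤ_[p]) : ℚ_[p])) * h + x * hu'
  · linear_combination (N : ℤ_[p]) * hu

theorem risingFactorial_one_add_inv_mul_pow {K : Type*} [Field K] (n k : ℕ) (hn : (n : K) ≠ 0) :
    risingFactorial (1 + 1 / (n : K)) k * (n : K) ^ k =
      ((∏ j ∈ Finset.range k, (n * (j + 1) + 1) : ℕ) : K) := by
  rw [risingFactorial]
  nth_rewrite 2 [← Finset.card_range k]
  rw [← Finset.prod_const, ← Finset.prod_mul_distrib, Nat.cast_prod]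
  refine Finset.prod_congr rfl fun j _ => ?_
  push_cast
  field_simp
  ring

theorem mul_factorial_div_risingFactorial_mul {K : Type*} [Field K] [CharZero K] (n k p : ℕ)
    (hn : n ≠ 0) :
    ((p : K) * ((k.factorial : K) / risingFactorial (1 + 1 / (n : K)) k)) *
      ((∏ j ∈ Finset.range k, (n * (j + 1) + 1) : ℕ) : K) = ((p * k.factorial * n ^ k : ℕ) : K) := by
  have hn' : (n : K) ≠ 0 := Nat.cast_ne_zero.2 hn
  have h := risingFactorial_one_add_inv_mul_pow (K := K) n k hn'
  have hne : ((∏ j ∈ Finset.range k, (n * (j + 1) + 1) : ℕ) : K) ≠ 0 :=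
    Nat.cast_ne_zero.2 (Finset.prod_ne_zero_iff.2 fun j _ => Nat.succ_ne_zero _)
  have hr : risingFactorial (1 + 1 / (n : K)) k ≠ 0 := by
    intro h0
    rw [h0, zero_mul] at h
    exact hne h.symm
  rw [← h]
  push_cast
  generalize risingFactorial (1 + 1 / (n : K)) k = x at hr
  field_simp

/-- For `k < r` no factor `n j + 1` with `j ≤ k` is divisible by `p`, so the explicit factor `p` of
the term survives, and its `n`-th power is zero modulo `p ^ 3`. -/
theorem exists_padicInt_eq_term_of_lt (p n r k : ℕ) [hp : Fact p.Prime] (hn : 3 ≤ n)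
    (hrn : n * r = p - 1) (hk : k < r) :
    ∃ z : ℤ_[p], (z : ℚ_[p]) =
      (p : ℚ_[p]) * ((k.factorial : ℚ_[p]) / risingFactorial (1 + 1 / (n : ℚ_[p])) k) ∧
      (PadicInt.toZModPow 3 z) ^ n = 0 := by
  have hp0 := hp.out.pos
  have hcop : Nat.Coprime (∏ j ∈ Finset.range k, (n * (j + 1) + 1)) p := by
    refine Nat.Coprime.prod_left fun j hj => ?_
    have hj' := Finset.mem_range.1 hj
    have : n * (j + 1 + 1) ≤ n * r := Nat.mul_le_mul_left _ (by omega)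
    have e : n * (j + 1 + 1) = n * (j + 1) + n := by ring
    exact coprime_of_pos_of_lt hp.out (by omega) (by omega)
  obtain ⟨z, hz, hzD⟩ := exists_padicInt_mul_natCast_eq p _ _ _ hcop
    (mul_factorial_div_risingFactorial_mul (K := ℚ_[p]) n k p (by omega))
  refine ⟨z, hz, ?_⟩
  have h := congrArg (fun y => (PadicInt.toZModPow 3 y) ^ n) hzD
  simp only [map_mul, map_natCast, mul_pow] at h
  have hu : IsUnit (((∏ j ∈ Finset.range k, (n * (j + 1) + 1) : ℕ) : ZModCube p) ^ n) :=
    (((ZMod.isUnit_iff_coprime _ _).2 (hcop.pow_right 3))).pow n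
  refine hu.mul_left_eq_zero.1 (h.trans ?_)
  have h3 : (p : ZModCube p) ^ n = 0 := by
    rw [← Nat.sub_add_cancel hn, pow_add, natCast_pow_three_eq_zero, mul_zero]
  push_cast
  rw [mul_pow, mul_pow, h3]
  ring

/-- Dividing the factor `n r + 1 = p` out of the denominator of the term with index `r + i`. The
remaining denominators are expressed through `t = m p`, which is `p / n` modulo `p ^ 3`: the
factors `n (j - r) + p` are `n (t + (j - r))`. -/
theorem exists_padicInt_eq_term_of_le (p n r i m : ℕ) [hp : Fact p.Prime] (hn : 3 ≤ n)
    (hr : 1 ≤ r) (hrn : n * r = p - 1) (hi : i < p - r) (hm : (n : ZModCube p) * m = 1) :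
    ∃ z : ℤ_[p], (z : ℚ_[p]) =
      (p : ℚ_[p]) * (((r + i).factorial : ℚ_[p]) /
        risingFactorial (1 + 1 / (n : ℚ_[p])) (r + i)) ∧
      (PadicInt.toZModPow 3 z : ZModCube p) *
        (∏ l ∈ Finset.range r, ((m : ZModCube p) * p - ((l + 1 : ℕ) : ZModCube p))) *
        ∏ j ∈ Finset.range i, (1 + m * p * ((j + 1 : ℕ) : ZModCube p)⁻¹) =
      (((i + 1).ascFactorial r : ℕ) : ZModCube p) := by
  have hp0 := hp.out.pos
  obtain ⟨s, rfl⟩ : ∃ s, r = s + 1 := ⟨r - 1, by omega⟩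
  have hnp : n < p := by
    have : n * 1 ≤ n * (s + 1) := Nat.mul_le_mul_left _ (by omega)
    omega
  set D1 := ∏ j ∈ Finset.range s, (n * (j + 1) + 1) with hD1
  set D2 := ∏ j ∈ Finset.range i, (n * (s + 1 + j + 1) + 1) with hD2
  have hsplit : ∏ j ∈ Finset.range (s + 1 + i), (n * (j + 1) + 1) = D1 * p * D2 := by
    rw [Finset.prod_range_add, Finset.prod_range_succ, hrn, Nat.sub_add_cancel hp.out.one_le]
  have hfac : ∀ j, n * (s + 1 + j + 1) + 1 = p + n * (j + 1) := by
    intro j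
    have : n * (s + 1 + j + 1) = n * (s + 1) + n * (j + 1) := by ring
    omega
  have hcop : Nat.Coprime (D1 * D2) p := by
    refine Nat.Coprime.mul_left (Nat.Coprime.prod_left fun j hj => ?_)
      (Nat.Coprime.prod_left fun j hj => ?_)
    · have hj' := Finset.mem_range.1 hj
      have : n * (j + 1 + 1) ≤ n * (s + 1) := Nat.mul_le_mul_left _ (by omega)
      have e : n * (j + 1 + 1) = n * (j + 1) + n := by ring
      exact coprime_of_pos_of_lt hp.out (by omega) (by omega)
    · have hj' := Finset.mem_range.1 hj
      rw [hfac]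
      simpa using Nat.Coprime.mul_left (coprime_of_pos_of_lt hp.out (by omega) hnp)
        (coprime_of_pos_of_lt hp.out (by omega : 0 < j + 1) (by omega))
  have hmain := mul_factorial_div_risingFactorial_mul (K := ℚ_[p]) n (s + 1 + i) p (by omega)
  rw [hsplit] at hmain
  have hpQ : (p : ℚ_[p]) ≠ 0 := Nat.cast_ne_zero.2 hp.out.ne_zero
  obtain ⟨z, hz, hzD⟩ := exists_padicInt_mul_natCast_eq p
    ((p : ℚ_[p]) * (((s + 1 + i).factorial : ℚ_[p]) /
        risingFactorial (1 + 1 / (n : ℚ_[p])) (s + 1 + i))) (D1 * D2)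
    ((s + 1 + i).factorial * n ^ (s + 1 + i)) hcop (by
      refine mul_left_cancel₀ hpQ ?_
      push_cast at hmain ⊢
      linear_combination hmain)
  refine ⟨z, hz, ?_⟩
  have h := congrArg (PadicInt.toZModPow 3) hzD
  rw [map_mul, map_natCast, map_natCast] at h
  have hnr : (n : ZModCube p) * ((s + 1 : ℕ) : ZModCube p) = p - 1 := by
    rw [← Nat.cast_mul, hrn, Nat.cast_sub hp.out.one_le, Nat.cast_one]
  have hE1 : (D1 : ZModCube p) = n ^ s *
      ∏ l ∈ Finset.range s, ((m : ZModCube p) * p - ((l + 1 : ℕ) : ZModCube p)) := by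
    rw [hD1, ← Finset.prod_range_reflect, Nat.cast_prod]
    have hpc := Finset.pow_card_mul_prod (s := Finset.range s) (b := (n : ZModCube p))
      (f := fun l => (m : ZModCube p) * p - ((l + 1 : ℕ) : ZModCube p))
    rw [Finset.card_range] at hpc
    rw [hpc]
    refine Finset.prod_congr rfl fun l hl => ?_
    have hl' := Finset.mem_range.1 hl
    have e : ((s - 1 - l + 1 : ℕ) : ZModCube p) =
        ((s + 1 : ℕ) : ZModCube p) - ((l + 1 : ℕ) : ZModCube p) := by
      rw [← Nat.cast_sub (by omega), show s - 1 - l + 1 = s + 1 - (l + 1) by omega]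
    rw [Nat.cast_add, Nat.cast_mul, e, Nat.cast_one]
    linear_combination hnr - (p : ZModCube p) * hm
  have hE2 : (D2 : ZModCube p) = n ^ i * ((i.factorial : ℕ) *
      ∏ j ∈ Finset.range i, (1 + m * p * ((j + 1 : ℕ) : ZModCube p)⁻¹)) := by
    rw [hD2, Nat.cast_prod, ← Finset.prod_range_add_one_eq_factorial, Nat.cast_prod]
    have hpc := Finset.pow_card_mul_prod (s := Finset.range i) (b := (n : ZModCube p))
      (f := fun j => ((j + 1 : ℕ) : ZModCube p) * (1 + m * p * ((j + 1 : ℕ) : ZModCube p)⁻¹))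
    rw [Finset.card_range] at hpc
    rw [← Finset.prod_mul_distrib, hpc]
    refine Finset.prod_congr rfl fun j hj => ?_
    have hj' := Finset.mem_range.1 hj
    have hu := natCast_mul_inv_of_lt (p := p) (j := j + 1) (by omega) (by omega)
    rw [hfac, Nat.cast_add, Nat.cast_mul]
    linear_combination (-(p : ZModCube p)) * hm - ((n : ZModCube p) * m * p) * hu
  have hfact : (((s + 1 + i).factorial : ℕ) : ZModCube p) =
      (i.factorial : ℕ) * (((i + 1).ascFactorial (s + 1) : ℕ) : ZModCube p) := by
    rw [← Nat.cast_mul, Nat.factorial_mul_ascFactorial, add_comm i]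
  rw [Nat.cast_mul, Nat.cast_mul, hE1, hE2, hfact, Nat.cast_pow] at h
  rw [Finset.prod_range_succ]
  have hnu : IsUnit ((n : ZModCube p) ^ (s + 1 + i)) :=
    (isUnit_natCast_of_pos_of_lt (by omega) hnp).pow _
  refine (hnu.mul (isUnit_factorial (i := i) (by omega))).mul_left_cancel ?_
  set B1 := ∏ l ∈ Finset.range s, ((m : ZModCube p) * p - ((l + 1 : ℕ) : ZModCube p))
  set B2 := ∏ j ∈ Finset.range i, (1 + m * p * ((j + 1 : ℕ) : ZModCube p)⁻¹)
  set Z := (PadicInt.toZModPow 3 z : ZModCube p)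
  have hlast : (n : ZModCube p) * (m * p - ((s + 1 : ℕ) : ZModCube p)) = 1 := by
    linear_combination (p : ZModCube p) * hm - hnr
  have hpow : (n : ZModCube p) ^ (s + 1 + i) = n ^ s * n ^ i * n := by ring
  rw [hpow] at h ⊢
  linear_combination h +
    (n ^ s * n ^ i * (i.factorial : ℕ) * Z * B1 * B2 : ZModCube p) * hlast

/-! ### The congruence -/

theorem padicModEq_sum_pow (n p : ℕ) [hpp : Fact p.Prime] (hn : 3 ≤ n) (hp : p ≡ 1 [MOD n]) :
    PadicModEq p 3
      (∑ k ∈ Finset.range p,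
        ((p : ℚ_[p]) * ((k.factorial : ℚ_[p]) /
          risingFactorial (1 + 1 / (n : ℚ_[p])) k)) ^ n)
      (-(((padicGamma p (n : ℤ_[p]).inv : ℤ_[p]) : ℚ_[p]) ^ n)) := by
  have hp2 := hpp.out.two_le
  obtain ⟨r, hrn'⟩ := (Nat.modEq_iff_dvd' hpp.out.one_le).1 hp.symm
  have hrn : n * r = p - 1 := hrn'.symm
  have hr : 1 ≤ r := by
    rcases Nat.eq_zero_or_pos r with rfl | h
    · omega
    · exact h
  have hrp : r < p := by
    have : 1 * r ≤ n * r := Nat.mul_le_mul_right _ (by omega)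
    omega
  have hnp : n ≤ p - 1 := by
    have : n * 1 ≤ n * r := Nat.mul_le_mul_left _ hr
    omega
  have h5 : 5 ≤ p := by
    -- Here `4 ≤ p` because `3 ≤ n ≤ p - 1`.
    have h4 : p ≠ 4 := by rintro rfl; exact absurd hpp.out (by norm_num)
    omega
  have heven : Even (r * n) := by
    rw [mul_comm, hrn]
    exact (hpp.out.odd_of_ne_two (by omega)).tsub_odd odd_one
  have : NeZero (p ^ 3) := ⟨pow_ne_zero _ hpp.out.ne_zero⟩
  have : Fact (1 < p ^ 3) := ⟨Nat.one_lt_pow three_ne_zero hpp.out.one_lt⟩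
  -- A natural number `m` congruent to `1 / n` modulo `p ^ 3`.
  set m : ℕ := ((n : ZModCube p)⁻¹).val with hm_def
  have hm : (n : ZModCube p) * m = 1 := by
    rw [hm_def, ZMod.natCast_zmod_val]
    exact natCast_mul_inv_of_lt (by omega) (by omega)
  have hm0 : 1 ≤ m := by
    rcases Nat.eq_zero_or_pos m with h | h
    · rw [h] at hm
      simp at hm
    · exact h
  have hmp : 1 * p ≤ m * p := Nat.mul_le_mul_right _ hm0
  set G : ZModCube p := PadicInt.toZModPow 3 (padicGamma p (n : ℤ_[p]).inv) with hG
  set A : ZModCube p :=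
    ∏ l ∈ Finset.range r, ((m : ZModCube p) * p - ((l + 1 : ℕ) : ZModCube p)) with hA
  -- The natural number `m p - r` is `1 / n` modulo `p ^ 3`.
  have hGnat : G = PadicInt.toZModPow 3 (padicGammaNat p (m * p - r)) := by
    refine toZModPow_padicGamma_eq p 3 _ (by omega) (by omega) _ ?_
    have hinv := congrArg (PadicInt.toZModPow 3) (natCast_mul_inv_of_modEq_one n p hp)
    rw [map_mul, map_natCast, map_one] at hinv
    have hnr : (n : ZModCube p) * r = p - 1 := by
      rw [← Nat.cast_mul, hrn, Nat.cast_sub hpp.out.one_le, Nat.cast_one]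
    refine (isUnit_natCast_of_pos_of_lt (p := p) (j := n) (by omega) (by omega)).mul_left_cancel ?_
    rw [hinv, Nat.cast_sub (by omega), Nat.cast_mul]
    linear_combination hnr - (p : ZModCube p) * hm
  have hGA : A ^ n * G ^ n = -(((p - 1).factorial : ℕ) : ZModCube p) := by
    have h := toZModPow_padicGammaNat_mul_self_sub p m (m * p - r) r hrp (by omega)
    rw [toZModPow_padicGammaNat_mul_self p m h5, ← hGnat, ← hA] at h
    have h' := congrArg (· ^ n) h
    simp only [mul_pow, ← pow_mul, heven.neg_one_pow, one_mul] at h'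
    rw [← h']
    refine neg_factorial_pow_eq_self_of_modEq_one p n m ?_ (Nat.mul_pos (by omega) hm0)
    rw [← ZMod.natCast_eq_natCast_iff]
    push_cast
    exact hm
  have hAu : IsUnit (A ^ n) :=
    isUnit_of_mul_isUnit_left (hGA ▸ (isUnit_factorial (i := p - 1) (by omega)).neg)
  have hlow : ∀ k, ∃ z : ℤ_[p], k < r → (z : ℚ_[p]) =
      (p : ℚ_[p]) * ((k.factorial : ℚ_[p]) / risingFactorial (1 + 1 / (n : ℚ_[p])) k) ∧
      (PadicInt.toZModPow 3 z) ^ n = 0 := by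
    intro k
    by_cases hk : k < r
    · obtain ⟨z, hz⟩ := exists_padicInt_eq_term_of_lt p n r k hn hrn hk
      exact ⟨z, fun _ => hz⟩
    · exact ⟨0, fun h => absurd h hk⟩
  have hhigh : ∀ i, ∃ z : ℤ_[p], i < p - r → (z : ℚ_[p]) =
      (p : ℚ_[p]) * (((r + i).factorial : ℚ_[p]) /
        risingFactorial (1 + 1 / (n : ℚ_[p])) (r + i)) ∧
      (PadicInt.toZModPow 3 z : ZModCube p) * A *
        ∏ j ∈ Finset.range i, (1 + m * p * ((j + 1 : ℕ) : ZModCube p)⁻¹) =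
      (((i + 1).ascFactorial r : ℕ) : ZModCube p) := by
    intro i
    by_cases hi : i < p - r
    · obtain ⟨z, hz⟩ := exists_padicInt_eq_term_of_le p n r i m hn hr hrn hi hm
      exact ⟨z, fun _ => hz⟩
    · exact ⟨0, fun h => absurd h hi⟩
  choose y hy using hlow
  choose z hz using hhigh
  have hsum := pow_mul_sum_pow_eq_factorial p n r hn h5 hr hrn m hm A
    (fun i => PadicInt.toZModPow 3 (z i)) fun i hi => (hz i hi).2
  have hcong : PadicInt.toZModPow 3 (∑ k ∈ Finset.range r, y k ^ n +
      ∑ i ∈ Finset.range (p - r), z i ^ n) =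
      PadicInt.toZModPow 3 (-(padicGamma p (n : ℤ_[p]).inv) ^ n) := by
    rw [map_add, map_sum, map_sum, map_neg, map_pow, ← hG,
      Finset.sum_eq_zero fun k hk => by rw [map_pow, (hy k (Finset.mem_range.1 hk)).2], zero_add]
    refine hAu.mul_left_cancel ?_
    simp_rw [map_pow]
    rw [hsum, mul_neg, hGA, neg_neg]
  obtain ⟨c, hc⟩ := (toZModPow_eq_iff_exists_mul p 3 _ _).1 hcong
  refine ⟨c, ?_⟩
  have hc' := congrArg (fun x : ℤ_[p] => (x : ℚ_[p])) hc
  push_cast at hc'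
  rw [← hc']
  congr 1
  have hrange := Finset.sum_range_add (fun k => ((p : ℚ_[p]) * ((k.factorial : ℚ_[p]) /
          risingFactorial (1 + 1 / (n : ℚ_[p])) k)) ^ n) r (p - r)
  rw [Nat.add_sub_cancel' hrp.le] at hrange
  rw [hrange]
  congr 1
  · rw [PadicInt.coe_sum]
    refine Finset.sum_congr rfl fun k hk => ?_
    rw [PadicInt.coe_pow, (hy k (Finset.mem_range.1 hk)).1]
  · rw [PadicInt.coe_sum]
    refine Finset.sum_congr rfl fun i hi => ?_
    rw [PadicInt.coe_pow, (hz i (Finset.mem_range.1 hi)).1]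

theorem risingFactorial_one {K : Type*} [Field K] (k : ℕ) :
    risingFactorial (1 : K) k = (k.factorial : K) := by
  rw [risingFactorial, ← Finset.prod_range_add_one_eq_factorial, Nat.cast_prod]
  refine Finset.prod_congr rfl fun j _ => ?_
  push_cast
  ring

theorem pow_mul_truncatedHypergeometric_eq_sum {K : Type*} [Field K] [CharZero K] (n q : ℕ)
    (hn : n ≠ 0) (x : K) :
    x ^ n * truncatedHypergeometric (fun _ : Fin (n + 1) => (1 : K))
      (fun _ : Fin n => ((n : K) + 1) / (n : K)) 1 q =
    ∑ k ∈ Finset.range (q + 1),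
      (x * ((k.factorial : K) / risingFactorial (1 + 1 / (n : K)) k)) ^ n := by
  rw [truncatedHypergeometric, Finset.mul_sum]
  refine Finset.sum_congr rfl fun k _ => ?_
  have hn' : (n : K) ≠ 0 := Nat.cast_ne_zero.2 hn
  have hk : (k.factorial : K) ≠ 0 := Nat.cast_ne_zero.2 k.factorial_ne_zero
  rw [show ((n : K) + 1) / n = 1 + 1 / n by field_simp]
  simp only [Finset.prod_const, Finset.card_univ, Fintype.card_fin, risingFactorial_one, one_pow]
  rw [mul_pow, div_pow, pow_succ]
  field_simp

theorem theorem1p2 (n p : ℕ) [Fact p.Prime] (hn : 3 ≤ n) (hp : p ≡ 1 [MOD n]) :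
    PadicModEq p 3
      ((p : ℚ_[p]) ^ n *
        truncatedHypergeometric (fun _ : Fin (n + 1) => (1 : ℚ_[p]))
          (fun _ : Fin n => ((n : ℚ_[p]) + 1) / (n : ℚ_[p])) 1 (p - 1))
      (-(((padicGamma p (n : ℤ_[p]).inv : ℤ_[p]) : ℚ_[p]) ^ n)) ∧
    PadicModEq p 3
      (∑ k ∈ Finset.range p,
        ((p : ℚ_[p]) * ((k.factorial : ℚ_[p]) /
          risingFactorial (1 + 1 / (n : ℚ_[p])) k)) ^ n)
      (-(((padicGamma p (n : ℤ_[p]).inv : ℤ_[p]) : ℚ_[p]) ^ n)) := by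
  have h := padicModEq_sum_pow n p hn hp
  refine ⟨?_, h⟩
  rw [pow_mul_truncatedHypergeometric_eq_sum n (p - 1) (by omega),
    Nat.sub_add_cancel (Fact.out : p.Prime).one_le]
  exact h
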